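/- Misère Connect $k$ is played on a board of width $w\ge 1$ and height $h\ge 1$ (both finite). Players P1 and P2 alternate, P1 first; the player to move chooses a column holding fewer than $h$ pieces and drops a piece of their own into it, which lands in the lowest empty cell of that column. The game ends as soon as a player has $k$ of their own pieces in a contiguous horizontal, vertical or diagonal line, and that player loses; if the board fills up without this happening, the game is drawn. We say that the game is a \emph{P2 win} if P2 has a strategy that guarantees that P1 loses, and a \emph{draw} if each player has a strategy that guarantees that they do not lose. \textbf{Theorem.} Let $k=2$. If $h=1$, then the game is a draw for $w\in\{1,2,4,6\}$ and a P2 win for every other width $w\ge 1$ (that is, for every odd $w\ge 3$ and every even $w\ge 8$). If $h>1$, then the game is a draw for $w=1$ and a P2 win for every $w>1$. -/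

import Mathlib

namespace MisereConnect

/-- The two players; `one` moves first. -/
inductive Player
  | one
  | two
  deriving DecidableEq

/-- The other player. -/
def Player.opponent : Player → Player
  | .one => .two
  | .two => .one

/-- A position on a board with `w` columns: the pieces of each column, listed from bottom to top,
and the player to move. -/
@[ext]
structure Position (w : ℕ) where
  columns : Fin w → List Player
  turn : Player

namespace Position

variable {w : ℕ}

/-- The starting position: an empty board with player one to move. -/
def initial (w : ℕ) : Position w where
  columns := fun _ => []
  turn := .one

/-- A column may be played if it holds fewer than `h` pieces. -/
def Legal (h : ℕ) (P : Position w) (c : Fin w) : Prop :=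
  (P.columns c).length < h

/-- The player to move drops a piece into column `c`, where it lands on top of the pieces
already there. -/
def play (P : Position w) (c : Fin w) : Position w where
  columns := Function.update P.columns c (P.columns c ++ [P.turn])
  turn := P.turn.opponent

/-- Player `q` has a piece in column `x` and row `y`, both counted from `0`. Coordinates off the
board are occupied by nobody. -/
def Occupies (P : Position w) (q : Player) (x y : ℤ) : Prop :=
  ∃ (c : Fin w) (r : ℕ), ((c : ℕ) : ℤ) = x ∧ (r : ℤ) = y ∧ (P.columns c)[r]? = some q

/-- The directions of a line on the board: horizontal, vertical and the two diagonals. -/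
def directions : Finset (ℤ × ℤ) := {(1, 0), (0, 1), (1, 1), (1, -1)}

/-- Player `q` has `k` pieces in a contiguous horizontal, vertical or diagonal line. -/
def Connected (k : ℕ) (P : Position w) (q : Player) : Prop :=
  ∃ x y : ℤ, ∃ d ∈ directions, ∀ i : ℕ, i < k → P.Occupies q (x + i * d.1) (y + i * d.2)

/-- The game is over once a player has connected `k`, or when every column is full. -/
def Over (k h : ℕ) (P : Position w) : Prop :=
  (∃ q : Player, P.Connected k q) ∨ ∀ c : Fin w, ¬ P.Legal h c

end Position

/-- A strategy names a column in every position. -/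
abbrev Strategy (w : ℕ) := Position w → Fin w

/-- The positions that can arise when player `p` follows the strategy `s` and the opponent plays
arbitrary legal moves; no move is made once the game is over. -/
inductive Reachable {w : ℕ} (k h : ℕ) (p : Player) (s : Strategy w) : Position w → Prop
  | start : Reachable k h p s (Position.initial w)
  | own (P : Position w) : Reachable k h p s P → ¬ P.Over k h → P.turn = p →
      P.Legal h (s P) → Reachable k h p s (P.play (s P))
  | other (P : Position w) (c : Fin w) : Reachable k h p s P → ¬ P.Over k h → P.turn ≠ p →
      P.Legal h c → Reachable k h p s (P.play c)

/-- The strategy `s` of player `p` always supplies a legal move when `p` has to move, and every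
game in which `p` follows it ends in a position with property `A`. (A game has at most `w * h`
moves, so each of them ends.) -/
def Ensures {w : ℕ} (k h : ℕ) (p : Player) (s : Strategy w) (A : Position w → Prop) : Prop :=
  ∀ P : Position w, Reachable k h p s P →
    (¬ P.Over k h → P.turn = p → P.Legal h (s P)) ∧ (P.Over k h → A P)

/-- Player `p` wins under optimal play: some strategy of `p` ensures that the opponent is the one
who connects `k`. -/
def WinFor (k w h : ℕ) (p : Player) : Prop :=
  ∃ s : Strategy w, Ensures k h p s fun P => P.Connected k p.opponent

/-- The game is a draw under optimal play: each player has a strategy that ensures that he does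
not lose, that is, that he does not connect `k`. -/
def IsDraw (k w h : ℕ) : Prop :=
  ∀ p : Player, ∃ s : Strategy w, Ensures k h p s fun P => ¬ P.Connected k p

end MisereConnect

/-!
Player two answers every move so as to restore an invariant. On a board of even height it suffices
to drop each piece on top of the piece that player one has just played. On a board of odd height,
player one can play on top of another piece only where the neighbouring columns are empty, and an
answer on top of that move is safe, so only the bottom row matters. There player two answers in the
next cell on the right. Such an answer can fail at the right end of the row, or to the left of an
exceptional earlier answer, but in at most two adjacent cells, only one of which player one can use;
another cell, which a neighbouring piece of player one protects, is kept in reserve for that move.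
Hence on at least two columns player two never loses.

With at least two rows and two columns, a full board contains a connection, and a board with an odd
number of cells is filled by a move of player one, so these games are not drawn. What remains is a
single row of even width. A full row without a connection alternates, so pieces of different players
never lie at an even distance in it. From width eight on, player two can produce such a pair while
keeping the invariant; for widths two, four and six a search of the game tree shows that player one
does not lose.
-/

namespace MisereConnect

section Strategies

variable {k w h : ℕ} {p : Player} {s : Strategy w}

theorem Position.exists_legal_of_not_over {P : Position w} (hP : ¬ P.Over k h) :
    ∃ c, P.Legal h c := by
  by_contra! hfull
  exact hP (Or.inr hfull)

theorem exists_ensures_of_invariant [NeZero w] {A : Position w → Prop} (I : Position w → Prop)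
    (initial : I (Position.initial w))
    (own : ∀ P, I P → ¬ P.Over k h → P.turn = p → ∃ c, P.Legal h c ∧ I (P.play c))
    (other : ∀ P c, I P → ¬ P.Over k h → P.turn ≠ p → P.Legal h c → I (P.play c))
    (terminal : ∀ P, I P → P.Over k h → A P) :
    ∃ s : Strategy w, Ensures k h p s A := by
  have move : ∀ P, ∃ c, I P → ¬ P.Over k h → P.turn = p → P.Legal h c ∧ I (P.play c) := by
    intro P
    by_cases hP : I P ∧ ¬ P.Over k h ∧ P.turn = p
    · obtain ⟨c, hc⟩ := own P hP.1 hP.2.1 hP.2.2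
      exact ⟨c, fun _ _ _ => hc⟩
    · exact ⟨0, fun hI hO ht => absurd ⟨hI, hO, ht⟩ hP⟩
  choose s hs using move
  refine ⟨s, fun P hR => ?_⟩
  have hI : I P := by
    induction hR with
    | start => exact initial
    | own P _ hO ht _ ih => exact (hs P ih hO ht).2
    | other P c _ hO ht hc ih => exact other P c ih hO ht hc
  exact ⟨fun hO ht => (hs P hI hO ht).1, terminal P hI⟩

theorem Reachable.induction_on_play {P : Position w} (hP : Reachable k h p s P)
    {I : Position w → Prop} (initial : I (Position.initial w))
    (play : ∀ P c, P.Legal h c → I P → I (P.play c)) : I P := by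
  induction hP with
  | start => exact initial
  | own P _ _ _ hc ih => exact play P _ hc ih
  | other P c _ _ _ hc ih => exact play P c hc ih

theorem Ensures.mono {A B : Position w → Prop} (hs : Ensures k h p s A)
    (hAB : ∀ P, Reachable k h p s P → P.Over k h → A P → B P) : Ensures k h p s B :=
  fun P hR => ⟨(hs P hR).1, fun hO => hAB P hR hO ((hs P hR).2 hO)⟩

theorem Player.ne_iff_eq_opponent {p q : Player} : q ≠ p ↔ q = p.opponent := by
  cases p <;> cases q <;> simp [opponent]

theorem Ensures.winFor (hs : Ensures k h p s fun P => ¬ P.Connected k p)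
    (full : ∀ P : Position w, (∀ c, ¬ P.Legal h c) → ∃ q, P.Connected k q) :
    WinFor k w h p := by
  refine ⟨s, hs.mono fun P _ hO hp => ?_⟩
  obtain ⟨q, hq⟩ : ∃ q, P.Connected k q := hO.elim id (full P)
  have hqp : q ≠ p := by rintro rfl; exact hp hq
  exact Player.ne_iff_eq_opponent.1 hqp ▸ hq

end Strategies

namespace Position

variable {k l w : ℕ} {P : Position w} {p q : Player} {x y : ℤ}

@[simp]
theorem turn_play (P : Position w) (c : Fin w) : (P.play c).turn = P.turn.opponent := rfl

theorem length_columns_play (P : Position w) (c d : Fin w) :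
    ((P.play c).columns d).length = (P.columns d).length + if d = c then 1 else 0 := by
  by_cases hd : d = c
  · subst hd
    simp [play]
  · simp [play, hd]

theorem occupies_natCast {c : Fin w} {r : ℕ} :
    P.Occupies q (c : ℕ) r ↔ (P.columns c)[r]? = some q := by
  constructor
  · rintro ⟨d, i, hd, hi, h⟩
    obtain rfl : d = c := Fin.ext (by exact_mod_cast hd)
    obtain rfl : i = r := by exact_mod_cast hi
    exact h
  · exact fun h => ⟨c, r, rfl, rfl, h⟩

theorem exists_occupies {c : Fin w} {r : ℕ} (hr : r < (P.columns c).length) :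
    ∃ q, P.Occupies q (c : ℕ) r :=
  ⟨(P.columns c)[r], occupies_natCast.2 (List.getElem?_eq_getElem hr)⟩

theorem Occupies.exists_lt_length (h : P.Occupies q x y) :
    ∃ (c : Fin w) (r : ℕ), ((c : ℕ) : ℤ) = x ∧ (r : ℤ) = y ∧ r < (P.columns c).length := by
  obtain ⟨c, r, hx, hy, h⟩ := h
  exact ⟨c, r, hx, hy, (List.getElem?_eq_some_iff.1 h).1⟩

theorem Occupies.unique (h : P.Occupies p x y) (h' : P.Occupies q x y) : p = q := by
  obtain ⟨c, r, rfl, rfl, h⟩ := h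
  exact Option.some.inj (h.symm.trans (occupies_natCast.1 h'))

theorem not_occupies_initial : ¬ (initial w).Occupies q x y := by
  simp [Occupies, initial]

theorem occupies_play {c : Fin w} : (P.play c).Occupies q x y ↔
    P.Occupies q x y ∨ q = P.turn ∧ x = (c : ℕ) ∧ y = (P.columns c).length := by
  have getElem?_play : ∀ (d : Fin w) (r : ℕ), ((P.play c).columns d)[r]? = some q ↔
      (P.columns d)[r]? = some q ∨ q = P.turn ∧ d = c ∧ r = (P.columns c).length := by
    intro d r
    by_cases hd : d = c
    · subst hd
      rcases lt_trichotomy r (P.columns d).length with hr | rfl | hr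
      · simp [play, List.getElem?_append_left hr, hr.ne]
      · simp [play, eq_comm]
      · simp [play, List.getElem?_eq_none, hr.ne', Nat.succ_le_of_lt hr, hr.le]
    · simp [play, hd]
  constructor
  · rintro ⟨d, r, rfl, rfl, h⟩
    rcases (getElem?_play d r).1 h with h | ⟨hq, rfl, rfl⟩
    · exact Or.inl ⟨d, r, rfl, rfl, h⟩
    · exact Or.inr ⟨hq, rfl, rfl⟩
  · rintro (⟨d, r, rfl, rfl, h⟩ | ⟨hq, rfl, rfl⟩)
    · exact ⟨d, r, rfl, rfl, (getElem?_play d r).2 (Or.inl h)⟩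
    · exact ⟨c, _, rfl, rfl, (getElem?_play c _).2 (Or.inr ⟨hq, rfl, rfl⟩)⟩

theorem occupies_play_of_ne {c : Fin w} (hq : q ≠ P.turn) :
    (P.play c).Occupies q x y ↔ P.Occupies q x y := by
  simp [occupies_play, hq]

theorem occupies_one_play_play (hP : P.turn = .one) {c d : Fin w} :
    ((P.play c).play d).Occupies .one x y ↔
      P.Occupies .one x y ∨ x = (c : ℕ) ∧ y = (P.columns c).length := by
  simp [occupies_play, hP, Player.opponent]

theorem occupies_two_play_play (hP : P.turn = .one) {c d : Fin w} :
    ((P.play c).play d).Occupies .two x y ↔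
      P.Occupies .two x y ∨ x = (d : ℕ) ∧ y = ((P.play c).columns d).length := by
  simp [occupies_play, hP, Player.opponent]

theorem not_connected_initial (hk : 0 < k) : ¬ (initial w).Connected k q := by
  rintro ⟨x, y, d, -, h⟩
  exact not_occupies_initial (h 0 hk)

theorem connected_play_of_ne {c : Fin w} (hq : q ≠ P.turn) :
    (P.play c).Connected k q ↔ P.Connected k q := by
  simp only [Connected, occupies_play_of_ne hq]

theorem Connected.mono (h : P.Connected l q) (hkl : k ≤ l) : P.Connected k q := by
  obtain ⟨x, y, d, hd, h⟩ := h
  exact ⟨x, y, d, hd, fun i hi => h i (hi.trans_le hkl)⟩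

theorem Connected.of_forall_occupies_below (h : P.Connected k p)
    (below : ∀ x y, P.Occupies p x y → P.Occupies q x (y - 1)) : P.Connected k q := by
  obtain ⟨x, y, d, hd, h⟩ := h
  refine ⟨x, y - 1, d, hd, fun i hi => ?_⟩
  simpa only [sub_add_eq_add_sub] using below _ _ (h i hi)

theorem connected_two_iff : P.Connected 2 q ↔ ∃ x y x' y', P.Occupies q x y ∧
    P.Occupies q x' y' ∧ (x ≠ x' ∨ y ≠ y') ∧ |x - x'| ≤ 1 ∧ |y - y'| ≤ 1 := by
  have connected_of_direction : ∀ {x y : ℤ}, ∀ d ∈ directions, P.Occupies q x y →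
      P.Occupies q (x + d.1) (y + d.2) → P.Connected 2 q := by
    intro x y d hd h h'
    refine ⟨x, y, d, hd, fun i hi => ?_⟩
    interval_cases i <;> simpa
  constructor
  · rintro ⟨x, y, d, hd, h⟩
    refine ⟨x, y, x + d.1, y + d.2, by simpa using h 0, by simpa using h 1, ?_⟩
    simp only [directions, Finset.mem_insert, Finset.mem_singleton] at hd
    rcases hd with rfl | rfl | rfl | rfl <;> simp
  · rintro ⟨x, y, x', y', h, h', hne, hx, hy⟩
    rw [abs_le] at hx hy
    obtain ⟨d, hd, ⟨rfl, rfl⟩ | ⟨rfl, rfl⟩⟩ : ∃ d ∈ directions,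
        (x' = x + d.1 ∧ y' = y + d.2) ∨ (x = x' + d.1 ∧ y = y' + d.2) := by
      simp only [directions, Finset.mem_insert, Finset.mem_singleton, exists_eq_or_imp,
        exists_eq_left]
      omega
    · exact connected_of_direction d hd h h'
    · exact connected_of_direction d hd h' h

theorem connected_two_play_iff {c : Fin w} (hq : P.turn = q) :
    (P.play c).Connected 2 q ↔ P.Connected 2 q ∨ ∃ x y, P.Occupies q x y ∧
      |x - (c : ℕ)| ≤ 1 ∧ |y - (P.columns c).length| ≤ 1 := by
  subst hq
  simp only [connected_two_iff, occupies_play, true_and]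
  constructor
  · rintro ⟨x, y, x', y', h | ⟨rfl, rfl⟩, h' | ⟨rfl, rfl⟩, hne, hx, hy⟩
    · exact Or.inl ⟨x, y, x', y', h, h', hne, hx, hy⟩
    · exact Or.inr ⟨x, y, h, hx, hy⟩
    · exact Or.inr ⟨x', y', h', by rwa [abs_sub_comm], by rwa [abs_sub_comm]⟩
    · simp at hne
  · rintro (⟨x, y, x', y', h, h', hne, hx, hy⟩ | ⟨x, y, h, hx, hy⟩)
    · exact ⟨x, y, x', y', Or.inl h, Or.inl h', hne, hx, hy⟩
    · refine ⟨x, y, _, _, Or.inl h, Or.inr ⟨rfl, rfl⟩, ?_, hx, hy⟩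
      obtain ⟨d, r, rfl, rfl, hr⟩ := h.exists_lt_length
      by_contra! hne
      obtain rfl : d = c := Fin.ext (by exact_mod_cast hne.1)
      omega

theorem exists_connected_two_of_full {h : ℕ} (hw : 1 < w) (hh : 1 < h)
    (full : ∀ c, ¬ P.Legal h c) : ∃ q, P.Connected 2 q := by
  have occupied : ∀ x y : ℕ, x < 2 → y < 2 → ∃ q, P.Occupies q x y := fun x y hx hy =>
    exists_occupies (c := ⟨x, by omega⟩) (by have := full ⟨x, by omega⟩; grind [Legal])
  obtain ⟨a, ha⟩ := occupied 0 0 (by norm_num) (by norm_num)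
  obtain ⟨b, hb⟩ := occupied 1 0 (by norm_num) (by norm_num)
  obtain ⟨c, hc⟩ := occupied 1 1 (by norm_num) (by norm_num)
  have pigeonhole : a = b ∨ a = c ∨ b = c := by cases a <;> cases b <;> cases c <;> simp
  rcases pigeonhole with rfl | rfl | rfl
  · exact ⟨_, connected_two_iff.2 ⟨_, _, _, _, ha, hb, by simp⟩⟩
  · exact ⟨_, connected_two_iff.2 ⟨_, _, _, _, ha, hc, by simp⟩⟩
  · exact ⟨_, connected_two_iff.2 ⟨_, _, _, _, hb, hc, by simp⟩⟩

end Position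

section Reachable

variable {k w h : ℕ} {p : Player} {s : Strategy w} {P : Position w}

theorem Reachable.length_columns_le (hP : Reachable k h p s P) (c : Fin w) :
    (P.columns c).length ≤ h := by
  refine hP.induction_on_play (I := fun P => (P.columns c).length ≤ h) (by simp [Position.initial])
    fun P d hd hI => ?_
  rw [Position.length_columns_play]
  split_ifs with hcd
  · exact hcd ▸ hd
  · exact hI

theorem Reachable.turn_eq_one_iff (hP : Reachable k h p s P) :
    P.turn = .one ↔ Even (∑ c, (P.columns c).length) := by
  refine hP.induction_on_play (I := fun P => P.turn = .one ↔ Even (∑ c, (P.columns c).length))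
    (by simp [Position.initial]) fun P c _ hI => ?_
  have sum_play : ∑ d, ((P.play c).columns d).length = ∑ d, (P.columns d).length + 1 := by
    simp [Position.length_columns_play, Finset.sum_add_distrib]
  rw [sum_play, Nat.even_add_one, ← hI, Position.turn_play]
  cases P.turn <;> simp [Player.opponent]

theorem Reachable.even_mul_of_full (hP : Reachable k h p s P) (ht : P.turn = .one)
    (full : ∀ c, ¬ P.Legal h c) : Even (w * h) := by
  have length_eq : ∀ c, (P.columns c).length = h := fun c =>
    le_antisymm (hP.length_columns_le c) (not_lt.1 (full c))
  simpa [length_eq] using hP.turn_eq_one_iff.1 ht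

end Reachable

section ReplyInvariant

variable {k w h : ℕ}

/-- Player one is to move and nobody has connected `k`. -/
def Position.AwaitsOne (k : ℕ) (P : Position w) : Prop :=
  P.turn = .one ∧ ∀ q, ¬ P.Connected k q

/-- A property of the positions with player one to move that player two can restore after every
move of player one that does not lose at once. -/
structure ReplyInvariant (k h : ℕ) (J : Position w → Prop) : Prop where
  initial : J (Position.initial w)
  exists_reply : ∀ P c, P.AwaitsOne k → J P → P.Legal h c → ¬ (P.play c).Connected k .one →
    ∃ d, (P.play c).Legal h d ∧ ¬ ((P.play c).play d).Connected k .two ∧ J ((P.play c).play d)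

variable {J : Position w → Prop}

theorem ReplyInvariant.exists_ensures [NeZero w] (hJ : ReplyInvariant k h J) (hk : 0 < k) :
    ∃ s : Strategy w, Ensures k h .two s fun P =>
      ¬ P.Connected k .two ∧ (P.Connected k .one ∨ P.AwaitsOne k ∧ J P) := by
  have quiet_of_reply : ∀ (P : Position w) d, P.turn = .two → ¬ P.Connected k .one →
      ¬ (P.play d).Connected k .two → (P.play d).AwaitsOne k := by
    refine fun P d ht h1 h2 => ⟨by simp [ht, Player.opponent], fun q hq => ?_⟩
    cases q
    · exact h1 ((Position.connected_play_of_ne (by simp [ht])).1 hq)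
    · exact h2 hq
  let awaitsTwo : Position w → Prop := fun P => P.turn = .two ∧ ¬ P.Connected k .two ∧
    (¬ P.Connected k .one → ∃ d, P.Legal h d ∧ (P.play d).AwaitsOne k ∧ J (P.play d))
  refine exists_ensures_of_invariant (fun P => P.AwaitsOne k ∧ J P ∨ awaitsTwo P)
    (Or.inl ⟨⟨rfl, fun _ => Position.not_connected_initial hk⟩, hJ.initial⟩) ?_ ?_ ?_
  · rintro P (⟨⟨ht, -⟩, -⟩ | ⟨-, -, hreply⟩) hO ht'
    · simp [ht'] at ht
    · obtain ⟨d, hd, hd'⟩ := hreply fun h1 => hO (Or.inl ⟨_, h1⟩)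
      exact ⟨d, hd, Or.inl hd'⟩
  · rintro P c (⟨hP, hJP⟩ | ⟨ht, -⟩) - ht' hc
    · have ht : (P.play c).turn = .two := by simp [hP.1, Player.opponent]
      refine Or.inr ⟨ht, fun h2 => hP.2 _ ((Position.connected_play_of_ne (by simp [hP.1])).1 h2),
        fun h1 => ?_⟩
      obtain ⟨d, hd, hd2, hdJ⟩ := hJ.exists_reply P c hP hJP hc h1
      exact ⟨d, hd, quiet_of_reply _ d ht h1 hd2, hdJ⟩
    · exact absurd ht ht'
  · rintro P (⟨hP, hJP⟩ | ⟨-, h2, hreply⟩) hO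
    · exact ⟨hP.2 _, Or.inr ⟨hP, hJP⟩⟩
    · refine ⟨h2, Or.inl ?_⟩
      by_contra h1
      obtain ⟨d, hd, -⟩ := hreply h1
      rcases hO with ⟨q, hq⟩ | hfull
      · cases q <;> contradiction
      · exact hfull d hd

theorem ReplyInvariant.exists_ensures_not_connected [NeZero w] (hJ : ReplyInvariant k h J)
    (hk : 0 < k) : ∃ s : Strategy w, Ensures k h .two s fun P => ¬ P.Connected k .two := by
  obtain ⟨s, hs⟩ := hJ.exists_ensures hk
  exact ⟨s, hs.mono fun _ _ _ hP => hP.1⟩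

theorem ReplyInvariant.winFor_two [NeZero w] (hJ : ReplyInvariant k h J) (hk : 0 < k)
    (not_full : ∀ P, P.AwaitsOne k → J P → ∃ c, P.Legal h c) : WinFor k w h .two := by
  obtain ⟨s, hs⟩ := hJ.exists_ensures hk
  refine ⟨s, hs.mono fun P _ hO hP => hP.2.resolve_right fun ⟨hP, hJP⟩ => ?_⟩
  obtain ⟨c, hc⟩ := not_full P hP hJP
  exact hO.elim (fun ⟨q, hq⟩ => hP.2 q hq) fun hfull => hfull c hc

theorem ReplyInvariant.winFor_two_of_odd_mul [NeZero w] (hJ : ReplyInvariant k h J) (hk : 0 < k)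
    (hwh : Odd (w * h)) : WinFor k w h .two := by
  obtain ⟨s, hs⟩ := hJ.exists_ensures hk
  refine ⟨s, hs.mono fun P hR hO hP => hP.2.resolve_right fun ⟨hP, _⟩ => ?_⟩
  exact hO.elim (fun ⟨q, hq⟩ => hP.2 q hq) fun hfull =>
    Nat.not_even_iff_odd.2 hwh (hR.even_mul_of_full hP.1 hfull)

end ReplyInvariant

section EvenHeight

variable {k w h : ℕ}

/-- Every piece of player two lies on top of a piece of player one, as when player two always
answers in the column that player one has just used. -/
structure Stacked (P : Position w) : Prop where
  even_length : ∀ c, Even (P.columns c).length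
  occupies_below : ∀ x y, P.Occupies .two x y → P.Occupies .one x (y - 1)

theorem Stacked.play_play {P : Position w} (hP : Stacked P) (ht : P.turn = .one) (c : Fin w) :
    Stacked ((P.play c).play c) where
  even_length d := by
    have := hP.even_length d
    simp only [Position.length_columns_play]
    split_ifs <;> grind
  occupies_below x y hxy := by
    rw [Position.occupies_two_play_play ht, Position.length_columns_play, if_pos rfl] at hxy
    rw [Position.occupies_one_play_play ht]
    rcases hxy with hxy | ⟨hx, rfl⟩
    · exact Or.inl (hP.occupies_below x y hxy)
    · exact Or.inr ⟨hx, by simp⟩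

theorem replyInvariant_stacked (k : ℕ) (hh : Even h) :
    ReplyInvariant k h (Stacked : Position w → Prop) where
  initial := ⟨by simp [Position.initial], fun _ _ hxy => (Position.not_occupies_initial hxy).elim⟩
  exists_reply P c hP hJ hc h1 := by
    have hJ' := hJ.play_play hP.1 c
    refine ⟨c, ?_, fun h2 => h1 ?_, hJ'⟩
    · have := hJ.even_length c
      rw [Position.Legal] at hc
      rw [Position.Legal, Position.length_columns_play, if_pos rfl]
      grind
    · rw [← Position.connected_play_of_ne (c := c) (by simp [hP.1, Player.opponent])]
      exact h2.of_forall_occupies_below hJ'.occupies_below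

end EvenHeight

section OneColumn

/-- The pieces of the only column alternate, starting with player one. -/
structure AlternatingColumn (P : Position 1) : Prop where
  even_row_iff : ∀ q x y, P.Occupies q x y → (Even y ↔ q = .one)
  even_length_iff : Even (P.columns 0).length ↔ P.turn = .one

theorem AlternatingColumn.play {P : Position 1} (hP : AlternatingColumn P) (c : Fin 1) :
    AlternatingColumn (P.play c) where
  even_row_iff q x y hq := by
    rcases Position.occupies_play.1 hq with hq | ⟨rfl, -, rfl⟩
    · exact hP.even_row_iff q x y hq
    · rw [Subsingleton.elim c 0]
      exact_mod_cast hP.even_length_iff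
  even_length_iff := by
    rw [Position.length_columns_play, if_pos (Subsingleton.elim _ _), Nat.even_add_one,
      hP.even_length_iff, Position.turn_play]
    cases P.turn <;> simp [Player.opponent]

theorem AlternatingColumn.not_connected_two {P : Position 1} (hP : AlternatingColumn P)
    (q : Player) : ¬ P.Connected 2 q := by
  rw [Position.connected_two_iff]
  rintro ⟨x, y, x', y', h, h', hne, -, hy⟩
  have same_parity := (hP.even_row_iff q x y h).trans (hP.even_row_iff q x' y' h').symm
  obtain ⟨c, -, rfl, -⟩ := h
  obtain ⟨c', -, rfl, -⟩ := h'
  rw [Subsingleton.elim c' c, abs_le] at *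
  grind

theorem isDraw_one_column {k : ℕ} (hk : 2 ≤ k) (h : ℕ) : IsDraw k 1 h := by
  refine fun p => ⟨fun _ => 0, fun P hR => ⟨fun hO _ => ?_, fun _ hP => ?_⟩⟩
  · obtain ⟨c, hc⟩ := Position.exists_legal_of_not_over hO
    exact Subsingleton.elim c 0 ▸ hc
  · have alternating : AlternatingColumn P := hR.induction_on_play
      ⟨fun _ _ _ hq => (Position.not_occupies_initial hq).elim, by simp [Position.initial]⟩
      fun P c _ hP => hP.play c
    exact alternating.not_connected_two p (hP.mono hk)

end OneColumn

/-- The pieces that the two players have in a single row of `w` cells, the cells being the integers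
from `0` to `w - 1`. -/
@[ext]
structure Row (w : ℕ) where
  one : Set ℤ
  two : Set ℤ

namespace Row

variable {w : ℕ} {R : Row w} {c d r e s : ℤ} {E F : Set ℤ} {S T : Row w → Prop}

/-- The cell `x` lies on the board and is empty. -/
def Vacant (R : Row w) (x : ℤ) : Prop := 0 ≤ x ∧ x < w ∧ x ∉ R.one ∧ x ∉ R.two

/-- Player one can occupy the cell `x` without connecting two pieces. -/
def SafeOne (R : Row w) (x : ℤ) : Prop := R.Vacant x ∧ x - 1 ∉ R.one ∧ x + 1 ∉ R.one

/-- Player two can occupy the cell `x` without connecting two pieces. -/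
def SafeTwo (R : Row w) (x : ℤ) : Prop := R.Vacant x ∧ x - 1 ∉ R.two ∧ x + 1 ∉ R.two

theorem SafeTwo.not_adjacent (hc : R.SafeTwo c) (hd : d ∈ R.two) (hdc : d ≠ c) :
    ¬ |d - c| ≤ 1 := by
  intro h
  rw [abs_le] at h
  obtain rfl | rfl : d = c - 1 ∨ d = c + 1 := by omega
  · exact hc.2.1 hd
  · exact hc.2.2 hd

/-- The row after player one occupies the cell `c` and player two replies in the cell `r`. -/
def exchange (R : Row w) (c r : ℤ) : Row w := ⟨insert c R.one, insert r R.two⟩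

theorem safeOne_exchange : (R.exchange c r).SafeOne d ↔
    R.SafeOne d ∧ d ≠ r ∧ d ≠ c ∧ d ≠ c - 1 ∧ d ≠ c + 1 := by
  simp only [SafeOne, Vacant, exchange, Set.mem_insert_iff, not_or, ← ne_eq, sub_eq_iff_eq_add,
    ← eq_sub_iff_add_eq]
  tauto

theorem safeTwo_exchange : (R.exchange c r).SafeTwo d ↔
    R.SafeTwo d ∧ d ≠ c ∧ d ≠ r ∧ d ≠ r - 1 ∧ d ≠ r + 1 := by
  simp only [SafeTwo, Vacant, exchange, Set.mem_insert_iff, not_or, ← ne_eq, sub_eq_iff_eq_add,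
    ← eq_sub_iff_add_eq]
  tauto

/-- In the row `R`, player two can answer the move `c` by the move `r` and reach a row in `S`. -/
def Answers (R : Row w) (S : Row w → Prop) (c r : ℤ) : Prop :=
  r ≠ c ∧ R.SafeTwo r ∧ S (R.exchange c r)

/-- Player two can return to `S` after every safe move of player one. -/
def Maintainable (S : Row w → Prop) : Prop :=
  ∀ R, S R → ∀ c, R.SafeOne c → ∃ r, R.Answers S c r

theorem Answers.mono (h : R.Answers S c r) (hST : S (R.exchange c r) → T (R.exchange c r)) :
    R.Answers T c r :=
  ⟨h.1, h.2.1, hST h.2.2⟩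

/-- Outside the exceptional set `E`, player two can answer each safe move of player one in the
next cell on the right. -/
def RightReplies (E : Set ℤ) (R : Row w) : Prop := ∀ c ∉ E, R.SafeOne c → R.SafeTwo (c + 1)

theorem RightReplies.exchange (hR : R.RightReplies E)
    (hF : ∀ d ∉ F, R.SafeOne d → d ≠ r → d ≠ c → d ≠ c - 1 → d ≠ c + 1 →
      d ∉ E ∧ d + 1 ≠ r ∧ d + 2 ≠ r) : (R.exchange c r).RightReplies F := by
  intro d hdF hd
  obtain ⟨hd, hdr, hdc, hdc', hdc''⟩ := safeOne_exchange.1 hd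
  obtain ⟨hdE, hdr', hdr''⟩ := hF d hdF hd hdr hdc hdc' hdc''
  exact safeTwo_exchange.2 ⟨hR d hdE hd, by grind⟩

theorem RightReplies.exchange_right (hR : R.RightReplies E) :
    (R.exchange c (c + 1)).RightReplies E :=
  hR.exchange (by grind)

theorem maintainable_rightReplies_empty : Maintainable (RightReplies (w := w) ∅) := fun R hR c hc =>
  ⟨c + 1, by simp, hR c (Set.notMem_empty c) hc, hR.exchange_right⟩

/-- Right replies may fail in the two adjacent cells `e` and `e + 1`, of which player one can use
only one. Player two answers that move in the cell `s`, which is reserved for it: a piece on `s - 1`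
keeps player one away from `s`, and keeps right replies off the cells next to `s`. -/
structure Reserve (e s : ℤ) (R : Row w) : Prop where
  guard : s - 1 ∈ R.one
  safeTwo : R.SafeTwo s
  rightReplies : R.RightReplies {e, e + 1}

theorem Reserve.ne_of_safeOne (hR : R.Reserve e s) (hd : R.SafeOne d) :
    d ≠ s - 2 ∧ d ≠ s - 1 ∧ d ≠ s := by
  have := hR.guard
  refine ⟨?_, ?_, ?_⟩ <;> rintro rfl <;> grind [SafeOne, Vacant]

theorem Reserve.exists_answers (hR : R.Reserve e s) (hc : R.SafeOne c) :
    ∃ r, R.Answers (fun R => R.RightReplies ∅ ∨ R.Reserve e s) c r := by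
  have hcs := hR.ne_of_safeOne hc
  by_cases hce : c = e ∨ c = e + 1
  · exact ⟨s, hcs.2.2.symm, hR.safeTwo, Or.inl (hR.rightReplies.exchange fun d _ hd =>
      by grind [hR.ne_of_safeOne hd])⟩
  · exact ⟨c + 1, by simp, hR.rightReplies c (by simpa using hce) hc, Or.inr
      ⟨Set.mem_insert_of_mem _ hR.guard, safeTwo_exchange.2 ⟨hR.safeTwo, by grind⟩,
        hR.rightReplies.exchange_right⟩⟩

/-- Right replies may fail only in the last cell, and both ends of the row are available to player
two. -/
structure OpenEnds (R : Row w) : Prop where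
  two_le : 2 ≤ w
  safeTwo_first : R.SafeTwo 0
  safeTwo_last : R.SafeTwo (w - 1)
  rightReplies : R.RightReplies {(w : ℤ) - 1}

theorem openEnds_empty (hw : 2 ≤ w) : (⟨∅, ∅⟩ : Row w).OpenEnds := by
  refine ⟨hw, ?_, ?_, ?_⟩ <;> grind [SafeOne, SafeTwo, Vacant, RightReplies]

/-- A property that enables player two to answer every safe move of player one and that can be
maintained until the row is full. -/
def Defended (R : Row w) : Prop := R.RightReplies ∅ ∨ R.OpenEnds ∨ ∃ e s, R.Reserve e s

theorem OpenEnds.exists_answers (hR : R.OpenEnds) (hc : R.SafeOne c) :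
    ∃ r, R.Answers Defended c r := by
  have hw := hR.two_le
  have bounds : ∀ {d}, R.SafeOne d → 0 ≤ d ∧ d < w := fun hd => ⟨hd.1.1, hd.1.2.1⟩
  have hcw := bounds hc
  by_cases hlast : c = w - 1
  · exact ⟨0, by grind, hR.safeTwo_first, Or.inl (hR.rightReplies.exchange fun d _ hd =>
      by grind [bounds hd])⟩
  by_cases hnext : c = w - 2 ∨ c = w - 3
  · exact ⟨w - 1, by grind, hR.safeTwo_last, Or.inl (hR.rightReplies.exchange fun d _ hd =>
      by grind [bounds hd])⟩
  have safeTwo_right : R.SafeTwo (c + 1) := hR.rightReplies c hlast hc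
  by_cases hfirst : c = 0
  · refine ⟨w - 1, by grind, hR.safeTwo_last, Or.inr (Or.inr ⟨w - 3, c + 1, ?_, ?_, ?_⟩)⟩
    · simp [exchange]
    · exact safeTwo_exchange.2 ⟨safeTwo_right, by grind⟩
    · exact hR.rightReplies.exchange (by grind)
  · exact ⟨c + 1, by simp, safeTwo_right, Or.inr (Or.inl ⟨hw,
      safeTwo_exchange.2 ⟨hR.safeTwo_first, by grind⟩,
      safeTwo_exchange.2 ⟨hR.safeTwo_last, by grind⟩, hR.rightReplies.exchange_right⟩)⟩

theorem maintainable_defended : Maintainable (Defended (w := w)) := by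
  rintro R (hR | hR | ⟨e, s, hR⟩) c hc
  · obtain ⟨r, hr⟩ := maintainable_rightReplies_empty R hR c hc
    exact ⟨r, hr.mono Or.inl⟩
  · exact hR.exists_answers hc
  · obtain ⟨r, hr⟩ := hR.exists_answers hc
    exact ⟨r, hr.mono fun h => h.imp id fun h => Or.inr ⟨e, s, h⟩⟩

/-- Pieces of different players lie at an even distance, which cannot happen in a full row without
connected pieces. -/
def Clashing (R : Row w) : Prop := ∃ x ∈ R.one, ∃ y ∈ R.two, Even (x - y)

theorem Clashing.exchange (hR : R.Clashing) : (R.exchange c r).Clashing := by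
  obtain ⟨x, hx, y, hy, hxy⟩ := hR
  exact ⟨x, Set.mem_insert_of_mem _ hx, y, Set.mem_insert_of_mem _ hy, hxy⟩

/-- In rows of large even width, player two can maintain this property and thereby obtain a clash.
The two nonempty rows that may lack one arise when player one opens at an end and player two takes
the other end. -/
def Winning (R : Row w) : Prop :=
  R = ⟨∅, ∅⟩ ∨ R = ⟨{0}, {(w : ℤ) - 1}⟩ ∨ R = ⟨{(w : ℤ) - 1}, {0}⟩ ∨ R.Clashing ∧ R.Defended

theorem Answers.winning (hrc : r ≠ c) (hr : R.SafeTwo r) (x : ℤ) (hx : x ∈ insert c R.one)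
    (hxr : Even (x - r)) (hR : (R.exchange c r).Defended) : R.Answers Winning c r :=
  ⟨hrc, hr, Or.inr (Or.inr (Or.inr ⟨⟨x, hx, r, Set.mem_insert _ _, hxr⟩, hR⟩))⟩

theorem exists_answers_winning_empty (hw : Even w) (hw8 : 8 ≤ w)
    (hc : (⟨∅, ∅⟩ : Row w).SafeOne c) : ∃ r, (⟨∅, ∅⟩ : Row w).Answers Winning c r := by
  have hcw : 0 ≤ c ∧ c < w := ⟨hc.1.1, hc.1.2.1⟩
  obtain rfl | rfl | h | rfl | h : c = 0 ∨ c = w - 1 ∨ (c = w - 2 ∨ c = w - 4) ∨ c = w - 3 ∨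
    1 ≤ c ∧ c ≤ w - 5 := by omega
  · refine ⟨w - 1, by grind, by grind [SafeTwo, Vacant], Or.inr (Or.inl ?_)⟩
    simp [exchange]
  · refine ⟨0, by grind, by grind [SafeTwo, Vacant], Or.inr (Or.inr (Or.inl ?_))⟩
    simp [exchange]
  · refine ⟨0, .winning (by grind) (by grind [SafeTwo, Vacant]) c (by simp) (by grind)
      (Or.inr (Or.inr ⟨w - 2, c + 1, ?_, ?_, ?_⟩))⟩ <;>
      grind [exchange, SafeOne, SafeTwo, Vacant, RightReplies]
  · refine ⟨w - 1, .winning (by grind) (by grind [SafeTwo, Vacant]) (w - 3) (by simp) (by grind)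
      (Or.inl ?_)⟩
    grind [exchange, SafeOne, SafeTwo, Vacant, RightReplies]
  · refine ⟨c + 2, .winning (by grind) (by grind [SafeTwo, Vacant]) c (by simp) (by grind)
      (Or.inr (Or.inl ⟨by omega, ?_, ?_, ?_⟩))⟩ <;>
      grind [exchange, SafeOne, SafeTwo, Vacant, RightReplies]

theorem exists_answers_winning_left_end (hw : Even w) (hw8 : 8 ≤ w)
    (hc : (⟨{0}, {(w : ℤ) - 1}⟩ : Row w).SafeOne c) :
    ∃ r, (⟨{0}, {(w : ℤ) - 1}⟩ : Row w).Answers Winning c r := by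
  have hcw : 2 ≤ c ∧ c ≤ w - 2 := by grind [SafeOne, Vacant]
  obtain h | rfl | h : c ≤ w - 5 ∨ c = w - 4 ∨ (c = w - 3 ∨ c = w - 2) := by omega
  · refine ⟨c + 2, .winning (by grind) (by grind [SafeTwo, Vacant]) c (by simp) (by grind)
      (Or.inr (Or.inr ⟨w - 3, 1, ?_, ?_, ?_⟩))⟩ <;>
      grind [exchange, SafeOne, SafeTwo, Vacant, RightReplies]
  · refine ⟨2, .winning (by grind) (by grind [SafeTwo, Vacant]) 0 (by simp) (by grind)
      (Or.inr (Or.inr ⟨w - 2, w - 3, ?_, ?_, ?_⟩))⟩ <;>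
      grind [exchange, SafeOne, SafeTwo, Vacant, RightReplies]
  · refine ⟨2, .winning (by grind) (by grind [SafeTwo, Vacant]) 0 (by simp) (by grind)
      (Or.inl ?_)⟩
    grind [exchange, SafeOne, SafeTwo, Vacant, RightReplies]

theorem exists_answers_winning_right_end (hw : Even w) (hw8 : 8 ≤ w)
    (hc : (⟨{(w : ℤ) - 1}, {0}⟩ : Row w).SafeOne c) :
    ∃ r, (⟨{(w : ℤ) - 1}, {0}⟩ : Row w).Answers Winning c r := by
  have hcw : 1 ≤ c ∧ c ≤ w - 3 := by grind [SafeOne, Vacant]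
  obtain rfl | h : c = w - 3 ∨ c ≤ w - 4 := by omega
  · refine ⟨3, .winning (by grind) (by grind [SafeTwo, Vacant]) (w - 3) (by simp) (by grind)
      (Or.inr (Or.inr ⟨1, w - 2, ?_, ?_, ?_⟩))⟩ <;>
      grind [exchange, SafeOne, SafeTwo, Vacant, RightReplies]
  · refine ⟨c + 2, .winning (by grind) (by grind [SafeTwo, Vacant]) c (by simp) (by grind)
      (Or.inl ?_)⟩
    grind [exchange, SafeOne, SafeTwo, Vacant, RightReplies]

theorem maintainable_winning (hw : Even w) (hw8 : 8 ≤ w) : Maintainable (Winning (w := w)) := by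
  rintro R (rfl | rfl | rfl | ⟨hclash, hR⟩) c hc
  · exact exists_answers_winning_empty hw hw8 hc
  · exact exists_answers_winning_left_end hw hw8 hc
  · exact exists_answers_winning_right_end hw hw8 hc
  · obtain ⟨r, hr⟩ := maintainable_defended R hR c hc
    exact ⟨r, hr.mono fun hD => Or.inr (Or.inr (Or.inr ⟨hclash.exchange, hD⟩))⟩

theorem Clashing.exists_vacant (hR : R.Clashing) (bounds : R.one ∪ R.two ⊆ Set.Ico 0 (w : ℤ))
    (hdisj : Disjoint R.one R.two) (hone : ∀ x ∈ R.one, x + 1 ∉ R.one)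
    (htwo : ∀ x ∈ R.two, x + 1 ∉ R.two) : ∃ x, R.Vacant x := by
  by_contra! full
  have mem_or_mem : ∀ n : ℕ, n < w → (n : ℤ) ∈ R.one ∨ (n : ℤ) ∈ R.two := by
    intro n hn
    by_contra! hnot
    exact full n ⟨n.cast_nonneg, by exact_mod_cast hn, hnot⟩
  have alternating : ∀ n : ℕ, n < w → ((n : ℤ) ∈ R.one ↔ (Even n ↔ (0 : ℤ) ∈ R.one)) := by
    intro n
    induction n with
    | zero => simp
    | succ n ih =>
      intro hn
      have := mem_or_mem n (by omega)
      have := mem_or_mem (n + 1) hn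
      push_cast at this ⊢
      grind
  obtain ⟨x, hx, y, hy, hxy⟩ := hR
  obtain ⟨hx0, hxw⟩ := bounds (Or.inl hx)
  obtain ⟨hy0, hyw⟩ := bounds (Or.inr hy)
  lift x to ℕ using hx0
  lift y to ℕ using hy0
  have := alternating x (by omega)
  have := alternating y (by omega)
  have := Set.disjoint_right.1 hdisj hy
  grind

theorem Winning.exists_vacant (hR : R.Winning) (hw : 3 ≤ w)
    (bounds : R.one ∪ R.two ⊆ Set.Ico 0 (w : ℤ)) (hdisj : Disjoint R.one R.two)
    (hone : ∀ x ∈ R.one, x + 1 ∉ R.one) (htwo : ∀ x ∈ R.two, x + 1 ∉ R.two) :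
    ∃ x, R.Vacant x := by
  rcases hR with rfl | rfl | rfl | ⟨hclash, -⟩
  · exact ⟨1, by grind [Vacant]⟩
  · exact ⟨1, by grind [Vacant]⟩
  · exact ⟨1, by grind [Vacant]⟩
  · exact hclash.exists_vacant bounds hdisj hone htwo

end Row

section OddHeight

variable {w h : ℕ}

/-- The bottom row of the board. -/
def Position.bottomRow (P : Position w) : Row w where
  one := {x | P.Occupies .one x 0}
  two := {x | P.Occupies .two x 0}

theorem Position.columns_eq_nil_iff_vacant {P : Position w} {c : Fin w} :
    P.columns c = [] ↔ P.bottomRow.Vacant (c : ℕ) := by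
  constructor
  · intro hc
    have not_occupies : ∀ q, ¬ P.Occupies q (c : ℕ) 0 := fun q hq => by
      simpa [hc] using occupies_natCast (r := 0).1 hq
    exact ⟨by simp, by simp, not_occupies .one, not_occupies .two⟩
  · rintro ⟨-, -, h1, h2⟩
    by_contra hc
    obtain ⟨_ | _, hq⟩ := P.exists_occupies (List.length_pos_of_ne_nil hc)
    · exact h1 hq
    · exact h2 hq

theorem Position.bottomRow_play_play {P : Position w} (ht : P.turn = .one) {c d : Fin w}
    (hc : P.columns c = []) (hd : P.columns d = []) (hdc : d ≠ c) :
    ((P.play c).play d).bottomRow = P.bottomRow.exchange (c : ℕ) (d : ℕ) := by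
  ext x <;> simp [bottomRow, Row.exchange, occupies_one_play_play ht, occupies_two_play_play ht,
    length_columns_play, hc, hd, hdc, or_comm]

theorem Position.bottomRow_play_play_self {P : Position w} (ht : P.turn = .one) {c : Fin w}
    (hc : P.columns c ≠ []) : ((P.play c).play c).bottomRow = P.bottomRow := by
  have : ((P.columns c).length : ℤ) ≠ 0 := by simpa using hc
  ext x <;> simp [bottomRow, occupies_one_play_play ht, occupies_two_play_play ht,
    length_columns_play] <;> grind

/-- The bottom row is in `S`, and player two has built on it only by answering on top of player
one's pieces, in columns with empty neighbours. -/
structure TowersOver (S : Row w → Prop) (P : Position w) : Prop where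
  bottomRow : S P.bottomRow
  even_row : ∀ x y, P.Occupies .two x y → Even y
  odd_length : ∀ c, P.columns c = [] ∨ Odd (P.columns c).length
  isolated : ∀ c d : Fin w, d ≠ c → |((d : ℕ) : ℤ) - (c : ℕ)| ≤ 1 →
    1 < (P.columns c).length → P.columns d = []

variable {S : Row w → Prop} {P : Position w} {c d : Fin w}

theorem TowersOver.occupies_one_one (hP : TowersOver S P) (hc : 1 < (P.columns c).length) :
    P.Occupies .one (c : ℕ) 1 := by
  obtain ⟨_ | _, hq⟩ := P.exists_occupies hc
  · exact hq
  · exact absurd (hP.even_row _ _ hq) (by decide)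

theorem TowersOver.occupies_two_zero (hP : TowersOver S P) (h1 : ¬ P.Connected 2 .one)
    (hc : 1 < (P.columns c).length) : P.Occupies .two (c : ℕ) 0 := by
  obtain ⟨_ | _, hq⟩ := P.exists_occupies (c := c) (r := 0) (by omega)
  · exact absurd (Position.connected_two_iff.2
      ⟨_, _, _, _, hq, hP.occupies_one_one hc, by simp⟩) h1
  · exact hq

/-- A piece of player one in row `1` of `c` is diagonally adjacent to the bottom cells next to `c`,
so only player two could have occupied these, and player two also owns the bottom cell of `c`. -/
theorem TowersOver.neighbor_eq_nil (hP : TowersOver S P) (h2 : ¬ P.Connected 2 .two)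
    (ht : P.turn = .one) (h1 : ¬ (P.play c).Connected 2 .one) (hc : P.columns c ≠ [])
    (hdc : d ≠ c) (hadj : |((d : ℕ) : ℤ) - (c : ℕ)| ≤ 1) : P.columns d = [] := by
  by_contra hd
  have hlen : (P.columns c).length = 1 := by
    by_contra hlen
    exact hd (hP.isolated c d hdc hadj (by have := List.length_pos_of_ne_nil hc; omega))
  have not_one : ∀ e : Fin w, |((e : ℕ) : ℤ) - (c : ℕ)| ≤ 1 → ¬ P.Occupies .one (e : ℕ) 0 :=
    fun e he ho => h1 ((Position.connected_two_play_iff ht).2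
      (Or.inr ⟨_, _, ho, he, by simp [hlen]⟩))
  have two_of_ne_nil : ∀ e : Fin w, |((e : ℕ) : ℤ) - (c : ℕ)| ≤ 1 → P.columns e ≠ [] →
      P.Occupies .two (e : ℕ) 0 := fun e he hne => by
    obtain ⟨_ | _, hq⟩ := P.exists_occupies (List.length_pos_of_ne_nil hne)
    · exact absurd hq (not_one e he)
    · exact hq
  exact h2 (Position.connected_two_iff.2 ⟨_, _, _, _, two_of_ne_nil d hadj hd,
    two_of_ne_nil c (by simp) hc, Or.inl (by simpa [Fin.val_inj] using hdc), hadj, by simp⟩)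

theorem TowersOver.play_play_self (hP : TowersOver S P) (ht : P.turn = .one)
    (hc : P.columns c ≠ []) (isolated : ∀ d ≠ c, |((d : ℕ) : ℤ) - (c : ℕ)| ≤ 1 → P.columns d = []) :
    TowersOver S ((P.play c).play c) where
  bottomRow := Position.bottomRow_play_play_self ht hc ▸ hP.bottomRow
  even_row x y hxy := by
    have hodd := (hP.odd_length c).resolve_left hc
    rw [Position.occupies_two_play_play ht, Position.length_columns_play, if_pos rfl] at hxy
    rcases hxy with hxy | ⟨-, rfl⟩
    · exact hP.even_row x y hxy
    · exact_mod_cast hodd.add_one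
  odd_length d := by
    have := hP.odd_length d
    simp only [← List.length_eq_zero_iff, Position.length_columns_play] at this hc ⊢
    grind
  isolated e d hde hadj he := by
    have := hP.isolated e d hde hadj
    have := isolated d
    simp only [← List.length_eq_zero_iff, Position.length_columns_play] at *
    grind

theorem TowersOver.not_connected_two_play_play_self (hP : TowersOver S P)
    (h2 : ¬ P.Connected 2 .two) (ht : P.turn = .one) (hc : P.columns c ≠ [])
    (isolated : ∀ d ≠ c, |((d : ℕ) : ℤ) - (c : ℕ)| ≤ 1 → P.columns d = []) :
    ¬ ((P.play c).play c).Connected 2 .two := by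
  rw [Position.connected_two_play_iff (by simp [ht, Player.opponent]),
    Position.connected_play_of_ne (by simp [ht])]
  rintro (h2' | ⟨x, y, hxy, hx, hy⟩)
  · exact h2 h2'
  rw [Position.occupies_play_of_ne (by simp [ht])] at hxy
  have heven := hP.even_row x y hxy
  have hodd := (hP.odd_length c).resolve_left hc
  obtain ⟨d, r, rfl, rfl, hr⟩ := hxy.exists_lt_length
  rw [Position.length_columns_play, if_pos rfl, abs_le] at hy
  have hd : d = c := by
    by_contra hd
    simp [isolated d hd hx] at hr
  subst hd
  grind

theorem TowersOver.play_play (hP : TowersOver S P) (hA : P.AwaitsOne 2)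
    (h1 : ¬ (P.play c).Connected 2 .one) (hc : P.columns c = [])
    (hd : P.bottomRow.Answers S (c : ℕ) (d : ℕ)) :
    TowersOver S ((P.play c).play d) := by
  have hdc : d ≠ c := by rintro rfl; exact hd.1 rfl
  have hd0 : P.columns d = [] := Position.columns_eq_nil_iff_vacant.2 hd.2.1.1
  refine ⟨?_, fun x y hxy => ?_, fun e => ?_, fun e f hfe hadj he => ?_⟩
  · rw [Position.bottomRow_play_play hA.1 hc hd0 hdc]
    exact hd.2.2
  · rw [Position.occupies_two_play_play hA.1, Position.length_columns_play, if_neg hdc, hd0] at hxy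
    rcases hxy with hxy | ⟨-, rfl⟩
    · exact hP.even_row x y hxy
    · simp
  · have := hP.odd_length e
    simp only [← List.length_eq_zero_iff, Position.length_columns_play] at this hc hd0 ⊢
    grind
  · have he' : 1 < (P.columns e).length := by
      simp only [Position.length_columns_play] at he
      grind
    have hfc : f ≠ c := by
      rintro rfl
      exact h1 ((Position.connected_two_play_iff hA.1).2 (Or.inr
        ⟨_, _, hP.occupies_one_one he', by rwa [abs_sub_comm], by simp [hc]⟩))
    have hfd : f ≠ d := by
      rintro rfl
      exact hd.2.1.not_adjacent (hP.occupies_two_zero (hA.2 _) he')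
        (by simpa [Fin.val_inj] using hfe.symm) (by rwa [abs_sub_comm])
    rw [← List.length_eq_zero_iff]
    simp [Position.length_columns_play, hfc, hfd, hP.isolated e f hfe hadj he']

theorem TowersOver.not_connected_two_play_play (hP : TowersOver S P) (hA : P.AwaitsOne 2)
    (hd0 : P.columns d = []) (hdc : d ≠ c) (hd : P.bottomRow.SafeTwo (d : ℕ)) :
    ¬ ((P.play c).play d).Connected 2 .two := by
  rw [Position.connected_two_play_iff (by simp [hA.1, Player.opponent]),
    Position.connected_play_of_ne (by simp [hA.1])]
  rintro (h2 | ⟨x, y, hxy, hx, hy⟩)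
  · exact hA.2 _ h2
  rw [Position.occupies_play_of_ne (by simp [hA.1])] at hxy
  have heven := hP.even_row x y hxy
  obtain ⟨e, r, rfl, rfl, hr⟩ := hxy.exists_lt_length
  have hr0 : r = 0 := by
    simp only [Position.length_columns_play, if_neg hdc, hd0, List.length_nil, abs_le] at hy
    grind
  subst hr0
  have hed : e ≠ d := by rintro rfl; simp [hd0] at hr
  exact hd.not_adjacent hxy (by simpa [Fin.val_inj] using hed) hx

theorem replyInvariant_towersOver (hh : Odd h) (hS : Row.Maintainable S) (h0 : S ⟨∅, ∅⟩) :
    ReplyInvariant 2 h (TowersOver S : Position w → Prop) where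
  initial := by
    have bottomRow_initial : (Position.initial w).bottomRow = ⟨∅, ∅⟩ := by
      ext x <;> simp [Position.bottomRow, Position.not_occupies_initial]
    exact ⟨bottomRow_initial ▸ h0, fun _ _ hxy => (Position.not_occupies_initial hxy).elim,
      fun _ => Or.inl rfl, fun _ _ _ _ _ => rfl⟩
  exists_reply P c hA hP hc h1 := by
    by_cases hnil : P.columns c = []
    · have hsafe : P.bottomRow.SafeOne (c : ℕ) := by
        refine ⟨Position.columns_eq_nil_iff_vacant.1 hnil, fun ho => ?_, fun ho => ?_⟩ <;>
          exact h1 ((Position.connected_two_play_iff hA.1).2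
            (Or.inr ⟨_, _, ho, by simp, by simp [hnil]⟩))
      obtain ⟨r, hr⟩ := hS _ hP.bottomRow _ hsafe
      obtain ⟨d, rfl⟩ : ∃ d : Fin w, ((d : ℕ) : ℤ) = r :=
        ⟨⟨r.toNat, by have := hr.2.1.1; grind [Row.Vacant]⟩, Int.toNat_of_nonneg hr.2.1.1.1⟩
      have hdc : d ≠ c := by rintro rfl; exact hr.1 rfl
      have hd0 : P.columns d = [] := Position.columns_eq_nil_iff_vacant.2 hr.2.1.1
      refine ⟨d, ?_, hP.not_connected_two_play_play hA hd0 hdc hr.2.1, hP.play_play hA h1 hnil hr⟩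
      simpa [Position.Legal, Position.length_columns_play, hdc, hd0] using hh.pos
    · have isolated : ∀ d ≠ c, |((d : ℕ) : ℤ) - (c : ℕ)| ≤ 1 → P.columns d = [] := fun d =>
        hP.neighbor_eq_nil (hA.2 _) hA.1 h1 hnil
      refine ⟨c, ?_, hP.not_connected_two_play_play_self (hA.2 _) hA.1 hnil isolated,
        hP.play_play_self hA.1 hnil isolated⟩
      have := (hP.odd_length c).resolve_left hnil
      rw [Position.Legal] at hc
      rw [Position.Legal, Position.length_columns_play, if_pos rfl]
      grind

end OddHeight

section NarrowBoards

/-- Player `p` can force the game to end within `n` moves in a position with property `A`. -/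
def Forces {w : ℕ} (k h : ℕ) (p : Player) (A : Position w → Prop) : ℕ → Position w → Prop
  | 0, P => P.Over k h ∧ A P
  | n + 1, P => P.Over k h ∧ A P ∨ ¬ P.Over k h ∧
      if P.turn = p then ∃ c, P.Legal h c ∧ Forces k h p A n (P.play c)
      else ∀ c, P.Legal h c → Forces k h p A n (P.play c)

variable {k w h n : ℕ} {p : Player} {A : Position w → Prop}

theorem exists_ensures_of_forces [NeZero w] (hA : Forces k h p A n (Position.initial w)) :
    ∃ s : Strategy w, Ensures k h p s A := by
  refine exists_ensures_of_invariant (fun P => ∃ n, Forces k h p A n P) ⟨n, hA⟩ ?_ ?_ ?_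
  · rintro P ⟨_ | n, hP⟩ hO ht
    · exact absurd hP.1 hO
    · simp only [Forces, hO, false_and, not_false_eq_true, true_and, ht, if_true, false_or] at hP
      exact hP.imp fun c hc => ⟨hc.1, n, hc.2⟩
  · rintro P c ⟨_ | n, hP⟩ hO ht hc
    · exact absurd hP.1 hO
    · simp only [Forces, hO, false_and, not_false_eq_true, true_and, ht, if_false, false_or] at hP
      exact ⟨n, hP c hc⟩
  · rintro P ⟨_ | n, hP⟩ hO
    · exact hP.2
    · exact (hP.resolve_right fun h => h.1 hO).2

theorem connected_two_iff_exists_columns {P : Position w} {q : Player} : P.Connected 2 q ↔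
    ∃ c d : Fin w, (c : ℕ) ≤ d + 1 ∧ (d : ℕ) ≤ c + 1 ∧
      ∃ r : Fin (P.columns c).length, (P.columns c)[r] = q ∧
      ∃ t : Fin (P.columns d).length, (P.columns d)[t] = q ∧
        (r : ℕ) ≤ t + 1 ∧ (t : ℕ) ≤ r + 1 ∧ (c ≠ d ∨ (r : ℕ) ≠ t) := by
  rw [Position.connected_two_iff]
  constructor
  · rintro ⟨_, _, _, _, ⟨c, r, rfl, rfl, hr⟩, ⟨d, t, rfl, rfl, ht⟩, hne, hx, hy⟩
    obtain ⟨hr', hr⟩ := List.getElem?_eq_some_iff.1 hr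
    obtain ⟨ht', ht⟩ := List.getElem?_eq_some_iff.1 ht
    rw [abs_le] at hx hy
    exact ⟨c, d, by omega, by omega, ⟨r, hr'⟩, hr, ⟨t, ht'⟩, ht, by simp; omega, by simp; omega,
      by simp; omega⟩
  · rintro ⟨c, d, hcd, hdc, r, hr, t, ht, hrt, htr, hne⟩
    refine ⟨_, _, _, _, Position.occupies_natCast.2 (List.getElem?_eq_some_iff.2 ⟨r.2, hr⟩),
      Position.occupies_natCast.2 (List.getElem?_eq_some_iff.2 ⟨t.2, ht⟩), ?_, ?_, ?_⟩
    · exact hne.imp (fun h => by simpa [Fin.val_inj] using h) (by exact_mod_cast ·)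
    · rw [abs_le]; omega
    · rw [abs_le]; omega

instance : Fintype Player := ⟨{.one, .two}, by rintro (_ | _) <;> simp⟩

instance (P : Position w) (q : Player) : Decidable (P.Connected 2 q) :=
  decidable_of_iff _ connected_two_iff_exists_columns.symm

instance (P : Position w) (c : Fin w) : Decidable (P.Legal h c) :=
  inferInstanceAs (Decidable ((P.columns c).length < h))

instance (P : Position w) : Decidable (P.Over 2 h) :=
  inferInstanceAs (Decidable ((∃ q, P.Connected 2 q) ∨ ∀ c, ¬ P.Legal h c))

instance Forces.instDecidable [DecidablePred A] [DecidablePred (Position.Over (w := w) k h)] :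
    ∀ (n : ℕ) (P : Position w), Decidable (Forces k h p A n P)
  | 0, P => inferInstanceAs (Decidable (P.Over k h ∧ A P))
  | n + 1, P => by
    have := fun c => Forces.instDecidable n (P.play c)
    unfold Forces
    infer_instance

theorem forces_one_initial_two :
    Forces 2 1 .one (fun P => ¬ P.Connected 2 .one) 2 (Position.initial 2) := by decide

theorem forces_one_initial_four :
    Forces 2 1 .one (fun P => ¬ P.Connected 2 .one) 4 (Position.initial 4) := by decide

theorem forces_one_initial_six :
    Forces 2 1 .one (fun P => ¬ P.Connected 2 .one) 6 (Position.initial 6) := by decide +kernel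

end NarrowBoards

section Results

variable {w h : ℕ}

theorem Position.exists_column_eq_nil_of_winning {P : Position w} (hw : 3 ≤ w)
    (hP : ∀ q, ¬ P.Connected 2 q) (hwin : P.bottomRow.Winning) : ∃ c, P.columns c = [] := by
  have bounds : P.bottomRow.one ∪ P.bottomRow.two ⊆ Set.Ico 0 (w : ℤ) := by
    rintro x (hx | hx) <;> obtain ⟨c, -, rfl, -⟩ := hx.exists_lt_length <;> simp
  have hdisj : Disjoint P.bottomRow.one P.bottomRow.two :=
    Set.disjoint_left.2 fun x h1 h2 => Player.noConfusion (h1.unique h2)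
  have not_adjacent : ∀ q x, P.Occupies q x 0 → ¬ P.Occupies q (x + 1) 0 := fun q x hx hx' =>
    hP q (connected_two_iff.2 ⟨_, _, _, _, hx, hx', by simp⟩)
  obtain ⟨x, hx⟩ := hwin.exists_vacant hw bounds hdisj (not_adjacent .one) (not_adjacent .two)
  obtain ⟨hx0, hxw, -⟩ := id hx
  lift x to ℕ using hx0
  exact ⟨⟨x, by omega⟩, columns_eq_nil_iff_vacant.2 hx⟩

theorem exists_ensures_two_not_connected_two (hw : 2 ≤ w) :
    ∃ s : Strategy w, Ensures 2 h .two s fun P => ¬ P.Connected 2 .two := by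
  have : NeZero w := ⟨by omega⟩
  rcases h.even_or_odd with hh | hh
  · exact (replyInvariant_stacked 2 hh).exists_ensures_not_connected two_pos
  · exact (replyInvariant_towersOver hh Row.maintainable_defended
      (Or.inr (Or.inl (Row.openEnds_empty hw)))).exists_ensures_not_connected two_pos

theorem winFor_two_of_one_lt_height (hw : 1 < w) (hh : 1 < h) : WinFor 2 w h .two := by
  obtain ⟨s, hs⟩ := exists_ensures_two_not_connected_two hw
  exact hs.winFor fun P => Position.exists_connected_two_of_full hw hh

theorem winFor_two_of_odd_width (hw : 2 ≤ w) (hwo : Odd w) (hh : Odd h) : WinFor 2 w h .two := by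
  have : NeZero w := ⟨by omega⟩
  exact (replyInvariant_towersOver hh Row.maintainable_defended
    (Or.inr (Or.inl (Row.openEnds_empty hw)))).winFor_two_of_odd_mul two_pos (hwo.mul hh)

theorem winFor_two_of_even_width (hw8 : 8 ≤ w) (hwe : Even w) (hh : Odd h) :
    WinFor 2 w h .two := by
  have : NeZero w := ⟨by omega⟩
  refine (replyInvariant_towersOver hh (Row.maintainable_winning hwe hw8)
    (Or.inl rfl)).winFor_two two_pos fun P hA hP => ?_
  obtain ⟨c, hc⟩ := Position.exists_column_eq_nil_of_winning (by omega) hA.2 hP.bottomRow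
  exact ⟨c, by simpa [Position.Legal, hc] using hh.pos⟩

theorem isDraw_two_of_forces {n : ℕ} (hw : 2 ≤ w)
    (hA : Forces 2 h .one (fun P => ¬ P.Connected 2 .one) n (Position.initial w)) :
    IsDraw 2 w h := by
  have : NeZero w := ⟨by omega⟩
  rintro (_ | _)
  · exact exists_ensures_of_forces hA
  · exact exists_ensures_two_not_connected_two hw

end Results

end MisereConnect

theorem mainTheorem6 (w h : ℕ) (hw : 1 ≤ w) (hh : 1 ≤ h) :
    (h = 1 →
      (w ∈ ({1, 2, 4, 6} : Set ℕ) → MisereConnect.IsDraw 2 w h) ∧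
      (w ∉ ({1, 2, 4, 6} : Set ℕ) → MisereConnect.WinFor 2 w h MisereConnect.Player.two)) ∧
    (1 < h →
      (w = 1 → MisereConnect.IsDraw 2 w h) ∧
      (1 < w → MisereConnect.WinFor 2 w h MisereConnect.Player.two)) := by
  refine ⟨?_, fun hh1 => ⟨?_, fun hw1 => MisereConnect.winFor_two_of_one_lt_height hw1 hh1⟩⟩
  · rintro rfl
    simp only [Set.mem_insert_iff, Set.mem_singleton_iff, not_or]
    refine ⟨?_, fun ⟨h1, h2, h4, h6⟩ => ?_⟩
    · rintro (rfl | rfl | rfl | rfl)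
      · exact MisereConnect.isDraw_one_column le_rfl 1
      · exact MisereConnect.isDraw_two_of_forces (by norm_num) MisereConnect.forces_one_initial_two
      · exact MisereConnect.isDraw_two_of_forces (by norm_num) MisereConnect.forces_one_initial_four
      · exact MisereConnect.isDraw_two_of_forces (by norm_num) MisereConnect.forces_one_initial_six
    · rcases w.even_or_odd with hwe | hwo
      · exact MisereConnect.winFor_two_of_even_width (by grind) hwe odd_one
      · exact MisereConnect.winFor_two_of_odd_width (by omega) hwo odd_one
  · rintro rfl
    exact MisereConnect.isDraw_one_column le_rfl h
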